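/- Let $\mathrm{SOL}$ be $\mathbb{R}^3$ with the Riemannian metric $ds^2=e^{-2z}dx^2+e^{2z}dy^2+dz^2$. A geodesic $\gamma(t)=(x(t),y(t),z(t))$, $t\in\mathbb{R}$, of $\mathrm{SOL}$ is called generic if none of the functions $x$, $y$, $z$ is constant. The modulus of a nonconstant geodesic is $$k=\sqrt{\frac{\|\dot\gamma\|^2-2|\dot x\dot y|}{\|\dot\gamma\|^2+2|\dot x\dot y|}},$$ which does not depend on $t$. For $0<k<1$ put $$T(k)=4\int_0^{\operatorname{arctanh}(k)}\frac{d\zeta}{\sqrt{1-\frac{1-k^2}{1+k^2}\cosh(2\zeta)}}.$$ Theorem. Let $\gamma$ be a generic unit-speed geodesic of $\mathrm{SOL}$, let $k$ be its modulus (then $0<k<1$), put $T=T(k)$, and fix $t_1\in\mathbb{R}$. (i) If $\dot z(t_1)=0$, then $\gamma(t_1)$ and $\gamma(t_1+T)$ are conjugate along $\gamma$, i.e. some nontrivial Jacobi field along $\gamma$ vanishes at $t_1$ and at $t_1+T\neq t_1$. (ii) If $\dot z(t_1)\neq 0$, there are two distinct geodesic arcs from $\gamma(t_1)$ to $\gamma(t_1+T)$,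 both of modulus $k$ and of length $T$. More precisely, the partner of $\gamma$ at time $t_1$, that is, the curve $$\gamma^\star(t)=\bigl(2x(t_1)-x(2t_1-t),\;2y(t_1)-y(2t_1-t),\;z(2t_1-t)\bigr),$$ is a unit-speed geodesic of modulus $k$ with $\gamma^\star(t_1)=\gamma(t_1)$ and $\gamma^\star(t_1+T)=\gamma(t_1+T)$; the arcs $\gamma|_{[t_1,t_1+T]}$ and $\gamma^\star|_{[t_1,t_1+T]}$ both have length $T$, and they are distinct as subsets of $\mathrm{SOL}$. -/

import Mathlib

open scoped ContDiff

noncomputable section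

namespace Sol

/-! ### Riemannian metrics on coordinate space

Points and tangent vectors are written in the global coordinates of `ℝⁿ`; a metric is given by its
matrix `g p` of coefficients in these coordinates. -/

/-- The partial derivative `∂f/∂xⱼ` at `p`. -/
def pderiv {n : ℕ} (f : (Fin n → ℝ) → ℝ) (j : Fin n) (p : Fin n → ℝ) : ℝ :=
  deriv (fun s : ℝ => f (Function.update p j s)) (p j)

/-- The inner product `⟨u, v⟩` of two tangent vectors at `p`. -/
def innerAt {n : ℕ} (g : (Fin n → ℝ) → Matrix (Fin n) (Fin n) ℝ) (p u v : Fin n → ℝ) : ℝ :=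
  ∑ i, ∑ j, g p i j * u i * v j

/-- The Christoffel symbol `Γⁱⱼₖ` of the Levi-Civita connection of `g` at `p`. -/
def christoffel {n : ℕ} (g : (Fin n → ℝ) → Matrix (Fin n) (Fin n) ℝ) (i j k : Fin n)
    (p : Fin n → ℝ) : ℝ :=
  (1 / 2) * ∑ m, (g p)⁻¹ i m *
    (pderiv (fun q => g q m k) j p + pderiv (fun q => g q m j) k p - pderiv (fun q => g q j k) m p)

/-- The Riemann curvature tensor `R(u, v)w` at `p`, with the sign convention
`R(U, V)W = ∇_U ∇_V W - ∇_V ∇_U W - ∇_[U,V] W`. -/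
def curvature {n : ℕ} (g : (Fin n → ℝ) → Matrix (Fin n) (Fin n) ℝ) (p u v w : Fin n → ℝ) :
    Fin n → ℝ :=
  fun i => ∑ j, ∑ k, ∑ l,
    (pderiv (christoffel g i k l) j p - pderiv (christoffel g i j l) k p
      + ∑ m, (christoffel g i j m p * christoffel g m k l p
        - christoffel g i k m p * christoffel g m j l p)) * u j * v k * w l

/-- The velocity vector `γ'(t)` of a curve. -/
def velocity {n : ℕ} (γ : ℝ → Fin n → ℝ) (t : ℝ) : Fin n → ℝ :=
  fun i => deriv (fun s => γ s i) t

/-- The covariant derivative `DV/dt` of a vector field `V` along the curve `γ`. -/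
def covDeriv {n : ℕ} (g : (Fin n → ℝ) → Matrix (Fin n) (Fin n) ℝ) (γ V : ℝ → Fin n → ℝ)
    (t : ℝ) : Fin n → ℝ :=
  fun i => deriv (fun s => V s i) t
    + ∑ j, ∑ k, christoffel g i j k (γ t) * velocity γ t j * V t k

/-- A (complete) geodesic of `g`: a smooth curve `γ : ℝ → ℝⁿ` with `D γ'/dt = 0`. -/
def IsGeodesic {n : ℕ} (g : (Fin n → ℝ) → Matrix (Fin n) (Fin n) ℝ) (γ : ℝ → Fin n → ℝ) : Prop :=
  ContDiff ℝ ∞ γ ∧ ∀ t, covDeriv g γ (velocity γ) t = 0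

/-- The speed `‖γ'(t)‖` of a curve. -/
def speed {n : ℕ} (g : (Fin n → ℝ) → Matrix (Fin n) (Fin n) ℝ) (γ : ℝ → Fin n → ℝ) (t : ℝ) : ℝ :=
  √(innerAt g (γ t) (velocity γ t) (velocity γ t))

/-- The curve `γ` has unit speed. -/
def IsUnitSpeed {n : ℕ} (g : (Fin n → ℝ) → Matrix (Fin n) (Fin n) ℝ) (γ : ℝ → Fin n → ℝ) : Prop :=
  ∀ t, speed g γ t = 1

/-- The length of the arc `γ|[s, t]`. -/
def arcLength {n : ℕ} (g : (Fin n → ℝ) → Matrix (Fin n) (Fin n) ℝ) (γ : ℝ → Fin n → ℝ)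
    (s t : ℝ) : ℝ :=
  ∫ τ in s..t, speed g γ τ

/-- A Jacobi field along `γ`: a smooth field `J` with `D²J/dt² + R(J, γ')γ' = 0`. -/
def IsJacobiField {n : ℕ} (g : (Fin n → ℝ) → Matrix (Fin n) (Fin n) ℝ)
    (γ J : ℝ → Fin n → ℝ) : Prop :=
  ContDiff ℝ ∞ J ∧ ∀ t,
    covDeriv g γ (covDeriv g γ J) t + curvature g (γ t) (J t) (velocity γ t) (velocity γ t) = 0

/-- The points `γ(s)` and `γ(t)`, `s ≠ t`, are conjugate along `γ`: some nontrivial Jacobi field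
along `γ` vanishes at both of them. -/
def AreConjugateAlong {n : ℕ} (g : (Fin n → ℝ) → Matrix (Fin n) (Fin n) ℝ) (γ : ℝ → Fin n → ℝ)
    (s t : ℝ) : Prop :=
  s ≠ t ∧ ∃ J : ℝ → Fin n → ℝ,
    IsJacobiField g γ J ∧ (∃ τ, J τ ≠ 0) ∧ J s = 0 ∧ J t = 0

/-! ### The geometry of SOL -/

/-- The metric `e^{-2z} dx² + e^{2z} dy² + dz²` of `SOL`, in the coordinates
`(x, y, z) = (p 0, p 1, p 2)`. -/
def metric (p : Fin 3 → ℝ) : Matrix (Fin 3) (Fin 3) ℝ :=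
  Matrix.diagonal ![Real.exp (-2 * p 2), Real.exp (2 * p 2), 1]

/-- A geodesic of `SOL` is generic if it is neither horizontal (constant height `z`) nor contained
in a vertical plane `x = const` or `y = const` (hyperbolic and vertical geodesics). -/
def IsGeneric (γ : ℝ → Fin 3 → ℝ) : Prop :=
  ∀ i : Fin 3, ¬ ∃ r : ℝ, ∀ t, γ t i = r

/-- The modulus `√((‖γ'‖² - 2|x'y'|) / (‖γ'‖² + 2|x'y'|))` of a curve in `SOL`, computed at the
time `t`; it does not depend on `t` when the curve is a geodesic. -/
def modulus (γ : ℝ → Fin 3 → ℝ) (t : ℝ) : ℝ :=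
  √((speed metric γ t ^ 2 - 2 * |velocity γ t 0 * velocity γ t 1|) /
    (speed metric γ t ^ 2 + 2 * |velocity γ t 0 * velocity γ t 1|))

/-- The amplitude `A(k)`. -/
def amplitude (k : ℝ) : ℝ := Real.artanh k

/-- The period `T(k)`. -/
def period (k : ℝ) : ℝ :=
  4 * ∫ ζ in (0 : ℝ)..amplitude k, 1 / √(1 - (1 - k ^ 2) / (1 + k ^ 2) * Real.cosh (2 * ζ))

/-- The partner `γ*` of the curve `γ` at the time `t₁`. -/
def partner (γ : ℝ → Fin 3 → ℝ) (t₁ : ℝ) (t : ℝ) : Fin 3 → ℝ :=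
  ![2 * γ t₁ 0 - γ (2 * t₁ - t) 0, 2 * γ t₁ 1 - γ (2 * t₁ - t) 1, γ (2 * t₁ - t) 2]

end Sol

end

/-! The translations in x and y are isometries, so a geodesic has constant momenta a, b with x' = a
e^{2z} and y' = b e^{-2z}. Unit speed then leaves one equation for z. After a shift of height it is
the pendulum w'² + μ cosh 2w = 1 with μ = 2|ab| = (1-k²)/(1+k²), whose period is T(k)
(`pendulum_periodic`). Hence z and the whole velocity are T-periodic, and the increments of x and y
over a time T do not depend on the starting time (`increment_eq_of_periodic_deriv`).

For (i), subtract from γ' the translation field with horizontal components x'(t₁), y'(t₁). This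
Jacobi field vanishes at t₁ because z'(t₁) = 0, and at t₁ + T by periodicity.

For (ii), the partner at t₁ + T involves γ(t₁ - T). Equal increments over [t₁ - T, t₁] and [t₁, t₁ +
T] make the x and y coordinates agree, and periodicity of z gives the third. The arcs differ because
z leaves its initial value in opposite directions along them (`image_partner_ne`). -/

noncomputable section

namespace Sol

/-! ### The hyperbolic pendulum and its period -/

section Pendulum

open Real

/-- The angular speed of the pendulum `w'' = -μ sinh (2w)` of energy `w'² + μ cosh (2w) = 1`, at the
phase `φ` given by `sinh w = s sin φ`, where `2μs² = 1 - μ`. -/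
def angularSpeed (μ φ : ℝ) : ℝ := √(2 * μ + (1 - μ) * sin φ ^ 2)

lemma angularSpeed_pos {μ : ℝ} (h0 : 0 < μ) (h1 : μ < 1) (φ : ℝ) : 0 < angularSpeed μ φ := by
  have : 0 < 1 - μ := by linarith
  unfold angularSpeed
  positivity

lemma continuous_one_div_angularSpeed {μ : ℝ} (h0 : 0 < μ) (h1 : μ < 1) :
    Continuous fun φ => 1 / angularSpeed μ φ := by
  refine continuous_const.div ?_ fun φ => (angularSpeed_pos h0 h1 φ).ne'
  unfold angularSpeed
  fun_prop

lemma angularSpeed_add_pi (μ φ : ℝ) : angularSpeed μ (φ + π) = angularSpeed μ φ := by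
  simp [angularSpeed, sin_add_pi]

lemma angularSpeed_pi_sub (μ φ : ℝ) : angularSpeed μ (π - φ) = angularSpeed μ φ := by
  simp [angularSpeed, sin_pi_sub]

lemma angularSpeed_eq {μ s : ℝ} (h0 : 0 < μ) (hs : 2 * μ * s ^ 2 = 1 - μ) (φ : ℝ) :
    angularSpeed μ φ = √(2 * μ) * √(1 + (s * sin φ) ^ 2) := by
  rw [angularSpeed, ← sqrt_mul (by positivity), ← hs]
  ring_nf

lemma integral_angularSpeed_full_turn {μ : ℝ} (h0 : 0 < μ) (h1 : μ < 1) :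
    ∫ φ in (0 : ℝ)..2 * π, 1 / angularSpeed μ φ
      = 4 * ∫ φ in (0 : ℝ)..π / 2, 1 / angularSpeed μ φ := by
  have hi := fun a b : ℝ =>
    (continuous_one_div_angularSpeed h0 h1).intervalIntegrable (μ := MeasureTheory.volume) a b
  have e1 : ∫ φ in π / 2..π, 1 / angularSpeed μ φ = ∫ φ in (0 : ℝ)..π / 2, 1 / angularSpeed μ φ := by
    have := intervalIntegral.integral_comp_sub_left (a := 0) (b := π / 2)
      (fun φ => 1 / angularSpeed μ φ) π
    simp only [angularSpeed_pi_sub] at this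
    rw [this]
    congr 1 <;> ring
  have e2 : ∫ φ in π..2 * π, 1 / angularSpeed μ φ = ∫ φ in (0 : ℝ)..π, 1 / angularSpeed μ φ := by
    have := intervalIntegral.integral_comp_add_right (a := 0) (b := π)
      (fun φ => 1 / angularSpeed μ φ) π
    simp only [angularSpeed_add_pi] at this
    rw [this]
    congr 1 <;> ring
  rw [← intervalIntegral.integral_add_adjacent_intervals (hi 0 π) (hi π (2 * π)), e2,
    ← intervalIntegral.integral_add_adjacent_intervals (hi 0 (π / 2)) (hi (π / 2) π), e1]
  ring

lemma image_arsinh_mul_sin {s : ℝ} (hs : 0 < s) :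
    (fun φ => arsinh (s * sin φ)) '' Set.Ioo 0 (π / 2) = Set.Ioo 0 (arsinh s) := by
  ext ζ
  constructor
  · rintro ⟨φ, ⟨hφ0, hφ1⟩, rfl⟩
    have hp := sin_pos_of_pos_of_lt_pi hφ0 (by linarith [pi_pos])
    have hl : sin φ < 1 := by
      rw [← sin_pi_div_two]
      exact sin_lt_sin_of_lt_of_le_pi_div_two (by linarith [pi_pos]) le_rfl hφ1
    refine ⟨arsinh_pos_iff.2 (by positivity), arsinh_strictMono ?_⟩
    nlinarith
  · rintro ⟨h0, h1⟩
    have h2 : 0 < sinh ζ := sinh_pos_iff.2 h0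
    have h3 : sinh ζ < s := by rw [← sinh_arsinh s]; exact sinh_lt_sinh.2 h1
    have h4 : 0 < sinh ζ / s := by positivity
    have h5 : sinh ζ / s < 1 := (div_lt_one hs).2 h3
    refine ⟨arcsin (sinh ζ / s), ⟨arcsin_pos.2 h4, arcsin_lt_pi_div_two.2 h5⟩, ?_⟩
    simp only
    rw [sin_arcsin (by linarith) h5.le, mul_div_cancel₀ _ hs.ne', arsinh_sinh]

/-- The substitution sinh ζ = s sin φ removes the singularity of the integrand at the turning point
ζ = arsinh s. It is made on open intervals, where the change of variables needs no separate
integrability proof. -/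
lemma integral_pendulum_quarter {μ s : ℝ} (h0 : 0 < μ) (hs0 : 0 < s)
    (hs : 2 * μ * s ^ 2 = 1 - μ) :
    ∫ ζ in (0 : ℝ)..arsinh s, 1 / √(1 - μ * cosh (2 * ζ))
      = ∫ φ in (0 : ℝ)..π / 2, 1 / angularSpeed μ φ := by
  have hA : 0 ≤ arsinh s := arsinh_nonneg_iff.2 hs0.le
  rw [intervalIntegral.integral_of_le hA, intervalIntegral.integral_of_le (by positivity),
    MeasureTheory.integral_Ioc_eq_integral_Ioo, MeasureTheory.integral_Ioc_eq_integral_Ioo,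
    ← image_arsinh_mul_sin hs0]
  rw [MeasureTheory.integral_image_eq_integral_abs_deriv_smul
    (f' := fun φ => (√(1 + (s * sin φ) ^ 2))⁻¹ * (s * cos φ)) measurableSet_Ioo]
  · refine MeasureTheory.setIntegral_congr_fun measurableSet_Ioo ?_
    rintro φ ⟨hφ0, hφ1⟩
    have hc : 0 < cos φ := cos_pos_of_mem_Ioo ⟨by linarith [pi_pos], hφ1⟩
    have e : 1 - μ * cosh (2 * arsinh (s * sin φ)) = (√(2 * μ) * (s * cos φ)) ^ 2 := by
      rw [cosh_two_mul, cosh_sq, sinh_arsinh, mul_pow √_, sq_sqrt (by positivity), mul_pow, mul_pow,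
        cos_sq']
      linear_combination -hs
    simp only [smul_eq_mul]
    rw [e, sqrt_sq (by positivity), angularSpeed_eq h0 hs, abs_of_pos (by positivity)]
    have : 0 < √(2 * μ) := by positivity
    have : 0 < √(1 + (s * sin φ) ^ 2) := by positivity
    field_simp
  · intro φ _
    exact (((hasDerivAt_sin φ).const_mul s).arsinh).hasDerivWithinAt
  · intro a ha b hb hab
    have := mul_left_cancel₀ hs0.ne' (arsinh_injective hab)
    exact injOn_sin ⟨by linarith [ha.1, pi_pos], ha.2.le⟩ ⟨by linarith [hb.1, pi_pos], hb.2.le⟩ this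

lemma period_eq_integral_angularSpeed {k : ℝ} (h0 : 0 < k) (h1 : k < 1) :
    period k = ∫ φ in (0 : ℝ)..2 * π, 1 / angularSpeed ((1 - k ^ 2) / (1 + k ^ 2)) φ := by
  have hk : 0 < 1 - k ^ 2 := by nlinarith
  have hμ0 : 0 < (1 - k ^ 2) / (1 + k ^ 2) := by positivity
  have hμ1 : (1 - k ^ 2) / (1 + k ^ 2) < 1 := by
    rw [div_lt_one (by positivity)]
    nlinarith
  -- Thus s = sinh (artanh k), which satisfies 2μs² = 1 - μ.
  have hA : amplitude k = arsinh (k / √(1 - k ^ 2)) := by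
    rw [amplitude, ← sinh_artanh ⟨by linarith, h1⟩, arsinh_sinh]
  rw [period, hA, integral_pendulum_quarter hμ0 (by positivity),
    integral_angularSpeed_full_turn hμ0 hμ1]
  rw [div_pow, sq_sqrt hk.le]
  field_simp
  ring

lemma period_pos {k : ℝ} (h0 : 0 < k) (h1 : k < 1) : 0 < period k := by
  have hk : 0 < 1 - k ^ 2 := by nlinarith
  have hμ0 : 0 < (1 - k ^ 2) / (1 + k ^ 2) := by positivity
  have hμ1 : (1 - k ^ 2) / (1 + k ^ 2) < 1 := by
    rw [div_lt_one (by positivity)]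
    nlinarith
  rw [period_eq_integral_angularSpeed h0 h1]
  refine intervalIntegral.intervalIntegral_pos_of_pos
    ((continuous_one_div_angularSpeed hμ0 hμ1).intervalIntegrable _ _)
    (fun φ => one_div_pos.2 (angularSpeed_pos hμ0 hμ1 φ)) (by positivity)

/-- A point of the unit circle moving with the scalar angular velocity `Ω` has a phase. -/
lemma exists_phase {p q Ω : ℝ → ℝ} (hΩ : Continuous Ω)
    (hp : ∀ t, HasDerivAt p (Ω t * q t) t) (hq : ∀ t, HasDerivAt q (-(Ω t * p t)) t)
    (h : ∀ t, p t ^ 2 + q t ^ 2 = 1) :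
    ∃ θ : ℝ → ℝ, (∀ t, HasDerivAt θ (Ω t) t) ∧ ∀ t, p t = sin (θ t) := by
  obtain ⟨θ₀, hs, hc⟩ : ∃ θ₀, p 0 = sin θ₀ ∧ q 0 = cos θ₀ := by
    have hn : ‖(⟨q 0, p 0⟩ : ℂ)‖ = 1 := by
      rw [← sq_eq_sq₀ (norm_nonneg _) zero_le_one, ← Complex.normSq_eq_norm_sq,
        Complex.normSq_apply]
      linarith [h 0]
    have hne : (⟨q 0, p 0⟩ : ℂ) ≠ 0 := by
      intro h0
      rw [h0] at hn
      simp at hn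
    refine ⟨Complex.arg ⟨q 0, p 0⟩, ?_, ?_⟩
    · rw [Complex.sin_arg, hn, div_one]
    · rw [Complex.cos_arg hne, hn, div_one]
  have hθ : ∀ t, HasDerivAt (fun t => θ₀ + ∫ u in (0 : ℝ)..t, Ω u) (Ω t) t := fun t =>
    ((hΩ.integral_hasStrictDerivAt 0 t).hasDerivAt).const_add θ₀
  set θ : ℝ → ℝ := fun t => θ₀ + ∫ u in (0 : ℝ)..t, Ω u with hθdef
  refine ⟨θ, hθ, fun t => ?_⟩
  -- Both (p, q) and (sin θ, cos θ) are unit vectors. Their inner product is constant and starts at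
  -- 1, so they coincide.
  have hd : ∀ t, HasDerivAt (fun t => p t * sin (θ t) + q t * cos (θ t)) 0 t := fun t => by
    have := ((hp t).mul (hθ t).sin).add ((hq t).mul (hθ t).cos)
    exact this.congr_deriv (by ring)
  have hconst : p t * sin (θ t) + q t * cos (θ t) = 1 := by
    have := is_const_of_deriv_eq_zero (fun t => (hd t).differentiableAt) (fun t => (hd t).deriv) t 0
    rw [this]
    simp only [hθdef, intervalIntegral.integral_same, add_zero]
    rw [hs, hc]
    linarith [sin_sq_add_cos_sq θ₀]
  have : (p t - sin (θ t)) ^ 2 + (q t - cos (θ t)) ^ 2 = 0 := by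
    linear_combination h t + sin_sq_add_cos_sq (θ t) - 2 * hconst
  have h3 : (p t - sin (θ t)) ^ 2 = 0 := by
    nlinarith [sq_nonneg (p t - sin (θ t)), sq_nonneg (q t - cos (θ t))]
  linarith [pow_eq_zero_iff (two_ne_zero) |>.1 h3]

/-- An autonomous flow on the circle is periodic. -/
lemma phase_add_period {μ : ℝ} (h0 : 0 < μ) (h1 : μ < 1) {θ : ℝ → ℝ}
    (hθ : ∀ t, HasDerivAt θ (angularSpeed μ (θ t)) t) (t : ℝ) :
    θ (t + ∫ φ in (0 : ℝ)..2 * π, 1 / angularSpeed μ φ) = θ t + 2 * π := by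
  have hcont := continuous_one_div_angularSpeed h0 h1
  have hG : ∀ x, HasDerivAt (fun x => ∫ φ in (0 : ℝ)..x, 1 / angularSpeed μ φ)
      (1 / angularSpeed μ x) x := fun x => (hcont.integral_hasStrictDerivAt 0 x).hasDerivAt
  -- G measures the time needed to reach a phase: G(θ t) - t is constant, and a full turn adds
  -- G(2π).
  set G : ℝ → ℝ := fun x => ∫ φ in (0 : ℝ)..x, 1 / angularSpeed μ φ with hGdef
  have hmono : StrictMono G := strictMono_of_deriv_pos fun x => by
    rw [(hG x).deriv]
    exact one_div_pos.2 (angularSpeed_pos h0 h1 x)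
  have hd : ∀ t, HasDerivAt (fun t => G (θ t) - t) 0 t := fun t => by
    have := ((hG (θ t)).comp t (hθ t)).sub (hasDerivAt_id t)
    rwa [one_div, inv_mul_cancel₀ (angularSpeed_pos h0 h1 _).ne', sub_self] at this
  have hconst := is_const_of_deriv_eq_zero (fun t => (hd t).differentiableAt)
    (fun t => (hd t).deriv) (t + G (2 * π)) t
  have hper : Function.Periodic (fun φ => 1 / angularSpeed μ φ) (2 * π) := fun φ => by
    simp only [angularSpeed, sin_add_two_pi]
  have hturn : G (θ t + 2 * π) = G (θ t) + G (2 * π) := by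
    have h2 := hper.intervalIntegral_add_eq (θ t) 0
    rw [zero_add] at h2
    simp only [hGdef]
    rw [← h2, intervalIntegral.integral_add_adjacent_intervals
      (hcont.intervalIntegrable _ _) (hcont.intervalIntegrable _ _)]
  apply hmono.injective
  rw [hturn]
  linarith

/-- The energy identity puts (√(2μ) sinh w, w') on a circle of radius √(1 - μ). The motion there is
an autonomous rotation that never stops, so turning points of w need no separate treatment. -/
lemma pendulum_periodic {k : ℝ} (h0 : 0 < k) (h1 : k < 1) {w v : ℝ → ℝ}
    (hw : ∀ t, HasDerivAt w (v t) t)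
    (hv : ∀ t, HasDerivAt v (-((1 - k ^ 2) / (1 + k ^ 2) * sinh (2 * w t))) t)
    (hE : ∀ t, v t ^ 2 + (1 - k ^ 2) / (1 + k ^ 2) * cosh (2 * w t) = 1) :
    Function.Periodic w (period k) := by
  have hk : 0 < 1 - k ^ 2 := by nlinarith
  have hμ0 : 0 < (1 - k ^ 2) / (1 + k ^ 2) := by positivity
  have hμ1 : (1 - k ^ 2) / (1 + k ^ 2) < 1 := by
    rw [div_lt_one (by positivity)]
    nlinarith
  rw [period_eq_integral_angularSpeed h0 h1]
  set μ := (1 - k ^ 2) / (1 + k ^ 2)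
  have hμ2 : 0 < 1 - μ := by linarith
  set r := √(2 * μ) with hr
  have hr0 : 0 < r := by positivity
  have hr2 : r ^ 2 = 2 * μ := sq_sqrt (by positivity)
  set d := √(1 - μ) with hd
  have hd0 : 0 < d := by positivity
  have hd2 : d ^ 2 = 1 - μ := sq_sqrt hμ2.le
  have hwc : Continuous w := continuous_iff_continuousAt.2 fun t => (hw t).continuousAt
  obtain ⟨θ, hθ, hsin⟩ := exists_phase (p := fun t => r / d * sinh (w t)) (q := fun t => v t / d)
    (Ω := fun t => r * cosh (w t)) (by fun_prop)
    (fun t => (((hw t).sinh).const_mul (r / d)).congr_deriv (by ring))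
    (fun t => ((hv t).div_const d).congr_deriv <| by
      rw [sinh_two_mul]
      field_simp
      linear_combination sinh (w t) * hr2)
    (fun t => by
      have := hE t
      rw [cosh_two_mul, cosh_sq] at this
      field_simp
      linear_combination this - hd2 + sinh (w t) ^ 2 * hr2)
  have hΩ : ∀ t, r * cosh (w t) = angularSpeed μ (θ t) := fun t => by
    rw [angularSpeed, ← hsin t]
    symm
    rw [sqrt_eq_iff_eq_sq (by positivity) (by positivity), mul_pow, mul_pow, div_pow, hd2, hr2,
      cosh_sq]
    field_simp
    ring
  intro t
  have hp := phase_add_period hμ0 hμ1 (fun t => hΩ t ▸ hθ t) t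
  have h3 := hsin (t + ∫ φ in (0 : ℝ)..2 * π, 1 / angularSpeed μ φ)
  rw [hp, sin_add_two_pi, ← hsin t] at h3
  exact sinh_injective (mul_left_cancel₀ (by positivity) h3)

end Pendulum

/-! ### Connection and curvature of SOL -/

/-- The Christoffel symbols of `SOL` at height `z`. -/
def christoffelTable (z : ℝ) : Fin 3 → Fin 3 → Fin 3 → ℝ :=
  ![![![0, 0, -1], ![0, 0, 0], ![-1, 0, 0]],
    ![![0, 0, 0], ![0, 0, 1], ![0, 1, 0]],
    ![![Real.exp (-2 * z), 0, 0], ![0, -Real.exp (2 * z), 0], ![0, 0, 0]]]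

lemma metric_inv (p : Fin 3 → ℝ) :
    (metric p)⁻¹ = Matrix.diagonal ![Real.exp (2 * p 2), Real.exp (-2 * p 2), 1] := by
  apply Matrix.inv_eq_right_inv
  rw [metric, Matrix.diagonal_mul_diagonal, ← Matrix.diagonal_one]
  congr 1
  ext i
  fin_cases i <;> simp [← Real.exp_add]

lemma pderiv_of_height {F : ℝ → ℝ} {F' : ℝ} {p : Fin 3 → ℝ} (hF : HasDerivAt F F' (p 2))
    (j : Fin 3) : pderiv (fun q => F (q 2)) j p = if j = 2 then F' else 0 := by
  unfold pderiv
  fin_cases j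
  · simp
  · simp
  · simpa using hF.deriv

lemma hasDerivAt_exp_mul (c z : ℝ) :
    HasDerivAt (fun s => Real.exp (c * s)) (c * Real.exp (c * z)) z := by
  have := ((hasDerivAt_id z).const_mul c).exp
  simpa [mul_comm] using this

lemma pderiv_metric (a b j : Fin 3) (p : Fin 3 → ℝ) :
    pderiv (fun q => metric q a b) j p =
      if j = 2 then
        Matrix.diagonal ![-2 * Real.exp (-2 * p 2), 2 * Real.exp (2 * p 2), 0] a b else 0 := by
  refine pderiv_of_height
    (F := fun s => Matrix.diagonal ![Real.exp (-2 * s), Real.exp (2 * s), 1] a b) ?_ j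
  have h1 := hasDerivAt_exp_mul (-2) (p 2)
  have h2 := hasDerivAt_exp_mul 2 (p 2)
  have h3 := hasDerivAt_const (p 2) (1 : ℝ)
  have h4 := hasDerivAt_const (p 2) (0 : ℝ)
  fin_cases a <;> fin_cases b <;> simp [Matrix.diagonal] <;>
    first | exact h4 | simpa using h1 | simpa using h2 | exact h3

lemma christoffel_metric (i j k : Fin 3) (p : Fin 3 → ℝ) :
    christoffel metric i j k p = christoffelTable (p 2) i j k := by
  have h1 : Real.exp (2 * p 2) * Real.exp (-(2 * p 2)) = 1 := by
    rw [← Real.exp_add]; simp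
  simp only [christoffel, pderiv_metric, metric_inv, Fin.sum_univ_three, christoffelTable]
  fin_cases i <;> fin_cases j <;> fin_cases k <;> simp [Matrix.diagonal] <;> linarith

lemma pderiv_christoffel_metric (i j k l : Fin 3) (p : Fin 3 → ℝ) :
    pderiv (christoffel metric i j k) l p =
      if l = 2 then
        (![0, 0, ![![-2 * Real.exp (-2 * p 2), 0, 0], ![0, -2 * Real.exp (2 * p 2), 0],
          ![0, 0, 0]]] : Fin 3 → Fin 3 → Fin 3 → ℝ) i j k else 0 := by
  rw [funext (christoffel_metric i j k)]
  refine pderiv_of_height (F := fun s => christoffelTable s i j k) ?_ l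
  have h1 := hasDerivAt_exp_mul (-2) (p 2)
  have h2 := (hasDerivAt_exp_mul 2 (p 2)).fun_neg
  unfold christoffelTable
  fin_cases i <;> fin_cases j <;> fin_cases k <;> simp <;>
    first | exact hasDerivAt_const _ _ | simpa using h1 | simpa using h2

lemma covDeriv_metric (γ V : ℝ → Fin 3 → ℝ) (t : ℝ) :
    covDeriv metric γ V t =
      ![deriv (fun s => V s 0) t - velocity γ t 0 * V t 2 - velocity γ t 2 * V t 0,
        deriv (fun s => V s 1) t + velocity γ t 1 * V t 2 + velocity γ t 2 * V t 1,
        deriv (fun s => V s 2) t + Real.exp (-2 * γ t 2) * velocity γ t 0 * V t 0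
          - Real.exp (2 * γ t 2) * velocity γ t 1 * V t 1] := by
  ext i
  simp only [covDeriv, christoffel_metric, Fin.sum_univ_three, christoffelTable]
  fin_cases i <;> simp <;> ring

lemma curvature_metric (p u v w : Fin 3 → ℝ) :
    curvature metric p u v w =
      ![Real.exp (2 * p 2) * (u 0 * v 1 - u 1 * v 0) * w 1 - (u 0 * v 2 - u 2 * v 0) * w 2,
        -Real.exp (-2 * p 2) * (u 0 * v 1 - u 1 * v 0) * w 0 - (u 1 * v 2 - u 2 * v 1) * w 2,
        Real.exp (-2 * p 2) * (u 0 * v 2 - u 2 * v 0) * w 0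
          + Real.exp (2 * p 2) * (u 1 * v 2 - u 2 * v 1) * w 1] := by
  ext i
  simp only [curvature, pderiv_christoffel_metric, christoffel_metric, Fin.sum_univ_three,
    christoffelTable]
  fin_cases i <;> simp <;> ring

lemma innerAt_metric (p u v : Fin 3 → ℝ) :
    innerAt metric p u v =
      Real.exp (-2 * p 2) * u 0 * v 0 + Real.exp (2 * p 2) * u 1 * v 1 + u 2 * v 2 := by
  simp [innerAt, metric, Fin.sum_univ_three, Matrix.diagonal]

/-! ### Geodesics of SOL: momenta and Jacobi fields -/

lemma hasDerivAt_coord {n : ℕ} {γ : ℝ → Fin n → ℝ} (hγ : ContDiff ℝ ∞ γ) (t : ℝ) (i : Fin n) :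
    HasDerivAt (fun s => γ s i) (velocity γ t i) t :=
  (((contDiff_pi.1 hγ i).differentiable (by simp)) t).hasDerivAt

lemma contDiff_velocity {n : ℕ} {γ : ℝ → Fin n → ℝ} (hγ : ContDiff ℝ ∞ γ) :
    ContDiff ℝ ∞ (velocity γ) :=
  contDiff_pi.2 fun i => (contDiff_infty_iff_deriv.1 (contDiff_pi.1 hγ i)).2

lemma velocity_eq {n : ℕ} {γ : ℝ → Fin n → ℝ} {t : ℝ} {v : Fin n → ℝ}
    (h : ∀ i, HasDerivAt (fun s => γ s i) (v i) t) : velocity γ t = v :=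
  funext fun i => (h i).deriv

lemma covDeriv_metric_eq {γ V : ℝ → Fin 3 → ℝ} {t V₀ V₁ V₂ : ℝ}
    (h0 : HasDerivAt (fun s => V s 0) V₀ t) (h1 : HasDerivAt (fun s => V s 1) V₁ t)
    (h2 : HasDerivAt (fun s => V s 2) V₂ t) :
    covDeriv metric γ V t =
      ![V₀ - velocity γ t 0 * V t 2 - velocity γ t 2 * V t 0,
        V₁ + velocity γ t 1 * V t 2 + velocity γ t 2 * V t 1,
        V₂ + Real.exp (-2 * γ t 2) * velocity γ t 0 * V t 0
          - Real.exp (2 * γ t 2) * velocity γ t 1 * V t 1] := by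
  rw [covDeriv_metric, h0.deriv, h1.deriv, h2.deriv]

/-- The geodesic equations of `SOL`. -/
lemma IsGeodesic.hasDerivAt_velocity {γ : ℝ → Fin 3 → ℝ} (hγ : IsGeodesic metric γ) (t : ℝ) :
    HasDerivAt (fun s => velocity γ s 0) (2 * velocity γ t 0 * velocity γ t 2) t ∧
    HasDerivAt (fun s => velocity γ s 1) (-(2 * velocity γ t 1 * velocity γ t 2)) t ∧
    HasDerivAt (fun s => velocity γ s 2)
      (Real.exp (2 * γ t 2) * velocity γ t 1 ^ 2 - Real.exp (-2 * γ t 2) * velocity γ t 0 ^ 2) t := by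
  have hv := hasDerivAt_coord (contDiff_velocity hγ.1) t
  have h := hγ.2 t
  rw [covDeriv_metric_eq (hv 0) (hv 1) (hv 2)] at h
  have e0 := congrFun h 0
  have e1 := congrFun h 1
  have e2 := congrFun h 2
  simp only [Matrix.cons_val_zero, Matrix.cons_val_one, Matrix.cons_val, Pi.zero_apply] at e0 e1 e2
  exact ⟨(hv 0).congr_deriv (by linarith), (hv 1).congr_deriv (by linarith),
    (hv 2).congr_deriv (by linarith)⟩

/-- The momenta of a geodesic with respect to `∂/∂x` and `∂/∂y` are constant. -/
lemma IsGeodesic.exists_momenta {γ : ℝ → Fin 3 → ℝ} (hγ : IsGeodesic metric γ) :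
    ∃ a b : ℝ, ∀ t, velocity γ t 0 = a * Real.exp (2 * γ t 2) ∧
      velocity γ t 1 = b * Real.exp (-2 * γ t 2) := by
  have key : ∀ (c : ℝ) (f : ℝ → ℝ), (∀ t, HasDerivAt f (c * f t * velocity γ t 2) t) →
      ∃ a : ℝ, ∀ t, f t = a * Real.exp (c * γ t 2) := by
    intro c f hf
    have hd : ∀ t, HasDerivAt (fun t => f t * Real.exp (-(c * γ t 2))) 0 t := fun t =>
      ((hf t).mul (((hasDerivAt_coord hγ.1 t 2).const_mul c).fun_neg.exp)).congr_deriv (by ring)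
    refine ⟨f 0 * Real.exp (-(c * γ 0 2)), fun t => ?_⟩
    have h := is_const_of_deriv_eq_zero (fun t => (hd t).differentiableAt)
      (fun t => (hd t).deriv) t 0
    rw [← h, mul_assoc, ← Real.exp_add]
    simp
  obtain ⟨a, ha⟩ := key 2 (fun t => velocity γ t 0) fun t => (hγ.hasDerivAt_velocity t).1
  obtain ⟨b, hb⟩ := key (-2) (fun t => velocity γ t 1) fun t =>
    (hγ.hasDerivAt_velocity t).2.1.congr_deriv (by ring)
  exact ⟨a, b, fun t => ⟨ha t, hb t⟩⟩

/-- The difference of the velocity field and a horizontal translation field is a Jacobi field. -/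
lemma IsGeodesic.isJacobiField_velocity_sub {γ : ℝ → Fin 3 → ℝ} (hγ : IsGeodesic metric γ)
    (α β : ℝ) : IsJacobiField metric γ fun t => velocity γ t - ![α, β, 0] := by
  refine ⟨(contDiff_velocity hγ.1).sub contDiff_const, fun t => ?_⟩
  -- Since Dγ'/dt = 0, only the translation field contributes.
  have hcov : covDeriv metric γ (fun t => velocity γ t - ![α, β, 0]) = fun t =>
      ![α * velocity γ t 2, -(β * velocity γ t 2),
        Real.exp (2 * γ t 2) * velocity γ t 1 * β - Real.exp (-2 * γ t 2) * velocity γ t 0 * α] := by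
    funext t
    obtain ⟨h0, h1, h2⟩ := hγ.hasDerivAt_velocity t
    rw [covDeriv_metric_eq (h0.sub_const α) (h1.sub_const β) (h2.sub_const 0)]
    ext i
    fin_cases i <;> simp <;> ring
  obtain ⟨h0, h1, h2⟩ := hγ.hasDerivAt_velocity t
  have hz := hasDerivAt_coord hγ.1 t 2
  have hmain := covDeriv_metric_eq (γ := γ) (V := fun t =>
      ![α * velocity γ t 2, -(β * velocity γ t 2),
        Real.exp (2 * γ t 2) * velocity γ t 1 * β - Real.exp (-2 * γ t 2) * velocity γ t 0 * α])
    (h2.const_mul α) (h2.const_mul β).fun_neg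
    (((((hz.const_mul 2).exp).mul h1).mul_const β).sub
      ((((hz.const_mul (-2)).exp).mul h0).mul_const α))
  rw [hcov, hmain, curvature_metric]
  have he : Real.exp (2 * γ t 2) * Real.exp (-2 * γ t 2) = 1 := by
    rw [← Real.exp_add]; simp
  set E := Real.exp (2 * γ t 2)
  set F := Real.exp (-2 * γ t 2)
  ext i
  fin_cases i <;> simp <;> ring

/-! ### The partner curve -/

/-- The velocity of the partner of a curve. -/
lemma velocity_partner {γ : ℝ → Fin 3 → ℝ} (hγ : ContDiff ℝ ∞ γ) (t₁ t : ℝ) :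
    velocity (partner γ t₁) t =
      ![velocity γ (2 * t₁ - t) 0, velocity γ (2 * t₁ - t) 1, -velocity γ (2 * t₁ - t) 2] := by
  have hr : HasDerivAt (fun s : ℝ => 2 * t₁ - s) (-1) t := (hasDerivAt_id t).const_sub _
  have h := fun i => (hasDerivAt_coord hγ (2 * t₁ - t) i).comp t hr
  apply velocity_eq
  intro i
  fin_cases i
  · exact ((h 0).const_sub (2 * γ t₁ 0)).congr_deriv (by simp)
  · exact ((h 1).const_sub (2 * γ t₁ 1)).congr_deriv (by simp)
  · exact (h 2).congr_deriv (by simp)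

lemma partner_height (γ : ℝ → Fin 3 → ℝ) (t₁ t : ℝ) :
    partner γ t₁ t 2 = γ (2 * t₁ - t) 2 := rfl

lemma contDiff_partner {γ : ℝ → Fin 3 → ℝ} (hγ : ContDiff ℝ ∞ γ) (t₁ : ℝ) :
    ContDiff ℝ ∞ (partner γ t₁) := by
  have h := fun i => (contDiff_pi.1 hγ i).comp
    (contDiff_const.sub contDiff_id : ContDiff ℝ ∞ fun s : ℝ => 2 * t₁ - s)
  refine contDiff_pi.2 fun i => ?_
  fin_cases i
  · exact contDiff_const.sub (h 0)
  · exact contDiff_const.sub (h 1)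
  · exact h 2

/-- The partner is γ run backwards and then turned by the isometry (x, y, z) ↦ (2x(t₁) - x, 2y(t₁) -
y, z). -/
lemma IsGeodesic.partner {γ : ℝ → Fin 3 → ℝ} (hγ : IsGeodesic metric γ) (t₁ : ℝ) :
    IsGeodesic metric (partner γ t₁) := by
  refine ⟨contDiff_partner hγ.1 t₁, fun t => ?_⟩
  have hr : HasDerivAt (fun s : ℝ => 2 * t₁ - s) (-1) t := (hasDerivAt_id t).const_sub _
  obtain ⟨h0, h1, h2⟩ := hγ.hasDerivAt_velocity (2 * t₁ - t)
  rw [funext (velocity_partner hγ.1 t₁)]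
  have hmain := covDeriv_metric_eq (γ := Sol.partner γ t₁) (V := fun t =>
    ![velocity γ (2 * t₁ - t) 0, velocity γ (2 * t₁ - t) 1, -velocity γ (2 * t₁ - t) 2])
    (h0.comp t hr) (h1.comp t hr) (h2.comp t hr).fun_neg
  rw [hmain, velocity_partner hγ.1, partner_height]
  ext i
  fin_cases i <;> simp <;> ring

lemma speed_partner {γ : ℝ → Fin 3 → ℝ} (hγ : ContDiff ℝ ∞ γ) (t₁ t : ℝ) :
    speed metric (partner γ t₁) t = speed metric γ (2 * t₁ - t) := by
  simp [speed, innerAt_metric, velocity_partner hγ, partner_height]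

lemma modulus_partner {γ : ℝ → Fin 3 → ℝ} (hγ : ContDiff ℝ ∞ γ) (t₁ t : ℝ) :
    modulus (partner γ t₁) t = modulus γ (2 * t₁ - t) := by
  simp [modulus, speed_partner hγ, velocity_partner hγ]

lemma IsUnitSpeed.arcLength {n : ℕ} {g : (Fin n → ℝ) → Matrix (Fin n) (Fin n) ℝ}
    {γ : ℝ → Fin n → ℝ} (h : IsUnitSpeed g γ) (s t : ℝ) : arcLength g γ s t = t - s := by
  simp [Sol.arcLength, h _]

/-- A geodesic arc with monotone first coordinate differs from its partner arc, unless its initial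
velocity is horizontal. -/
lemma image_partner_ne {γ : ℝ → Fin 3 → ℝ} (hγ : ContDiff ℝ ∞ γ) {a : ℝ} (ha : a ≠ 0)
    (hx : ∀ t, velocity γ t 0 = a * Real.exp (2 * γ t 2)) {t₁ t₂ : ℝ} (ht : t₁ < t₂)
    (hz : velocity γ t₁ 2 ≠ 0) :
    partner γ t₁ '' Set.Icc t₁ t₂ ≠ γ '' Set.Icc t₁ t₂ := by
  have ha2 : 0 < a * a := mul_self_pos.2 ha
  -- The factor a, like c = z'(t₁) below, treats both signs at once.
  have hmono : StrictMono fun t => a * γ t 0 := strictMono_of_deriv_pos fun t => by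
    rw [((hasDerivAt_coord hγ t 0).const_mul a).deriv, hx, ← mul_assoc]
    positivity
  set c := velocity γ t₁ 2 with hc
  have hu : HasDerivAt (fun t => c * γ t 2) (c * c) t₁ := (hasDerivAt_coord hγ t₁ 2).const_mul c
  have hcc : 0 < c * c := mul_self_pos.2 hz
  obtain ⟨δ, hδ, hright, hleft⟩ : ∃ δ > 0, (∀ t, t₁ < t → t < t₁ + δ → c * γ t₁ 2 < c * γ t 2) ∧
      ∀ t, t₁ - δ < t → t < t₁ → c * γ t 2 < c * γ t₁ 2 := by
    have h1 := hasDerivAt_iff_tendsto_slope.1 hu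
    have h2 := h1.eventually (lt_mem_nhds hcc)
    rw [eventually_nhdsWithin_iff, Metric.eventually_nhds_iff] at h2
    obtain ⟨δ, hδ, h⟩ := h2
    refine ⟨δ, hδ, fun t h3 h4 => ?_, fun t h3 h4 => ?_⟩
    · have := h (y := t) (by rw [Real.dist_eq, abs_lt]; constructor <;> linarith) h3.ne'
      rw [slope_def_field, div_pos_iff] at this
      rcases this with h | h <;> linarith [h.1, h.2]
    · have := h (y := t) (by rw [Real.dist_eq, abs_lt]; constructor <;> linarith) h4.ne
      rw [slope_def_field, div_pos_iff] at this
      rcases this with h | h <;> linarith [h.1, h.2]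
  intro heq
  have hcont : Continuous fun t => a * partner γ t₁ t 0 :=
    continuous_const.mul (contDiff_pi.1 (contDiff_partner hγ t₁) 0).continuous
  have hp1 : partner γ t₁ t₁ 0 = γ t₁ 0 := by
    simp only [partner, Matrix.cons_val_zero, show 2 * t₁ - t₁ = t₁ by ring]; ring
  have hlt : a * partner γ t₁ t₁ 0 < a * γ (t₁ + δ) 0 := by
    rw [hp1]; exact hmono (by linarith)
  have hev := hcont.continuousAt.eventually (gt_mem_nhds hlt)
  have hmem : ∀ᶠ s in nhdsWithin t₁ (Set.Ioi t₁), s ∈ Set.Ioo t₁ (min (t₁ + δ) t₂) :=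
    Ioo_mem_nhdsGT (lt_min (by linarith) ht)
  -- For s slightly after t₁, a point γ(s') equal to the partner's point at s has s' in (t₁, t₁ +
  -- δ), by comparing first coordinates. Then c z lies above its initial value on γ but below it on
  -- the partner.
  obtain ⟨s, ⟨hs1, hs2⟩, hs3⟩ := (hmem.and (hev.filter_mono nhdsWithin_le_nhds)).exists
  rw [lt_min_iff] at hs2
  obtain ⟨s', -, hs'⟩ : partner γ t₁ s ∈ γ '' Set.Icc t₁ t₂ :=
    heq ▸ Set.mem_image_of_mem _ ⟨hs1.le, hs2.2.le⟩
  have hx' : a * γ s' 0 = a * partner γ t₁ s 0 := by rw [hs']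
  have h5 : s' < t₁ + δ := hmono.lt_iff_lt.1 (by simpa only [hx'] using hs3)
  have h6 : t₁ < s' := by
    apply hmono.lt_iff_lt.1
    have h7 : a * γ (2 * t₁ - s) 0 < a * γ t₁ 0 := hmono (by linarith)
    have h8 : partner γ t₁ s 0 = 2 * γ t₁ 0 - γ (2 * t₁ - s) 0 := rfl
    simp only [hx', h8]
    linarith
  have h9 := hright s' h6 h5
  have h10 := hleft (2 * t₁ - s) (by linarith) (by linarith)
  rw [hs', partner_height] at h9
  linarith

/-! ### Conservation laws and periodicity of the height -/

lemma IsUnitSpeed.innerAt_eq_one {γ : ℝ → Fin 3 → ℝ} (h : IsUnitSpeed metric γ) (t : ℝ) :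
    Real.exp (-2 * γ t 2) * velocity γ t 0 ^ 2 + Real.exp (2 * γ t 2) * velocity γ t 1 ^ 2
      + velocity γ t 2 ^ 2 = 1 := by
  have := h t
  rw [speed, Real.sqrt_eq_one, innerAt_metric] at this
  linarith

/-- The conservation laws of a generic unit-speed geodesic: nonzero momenta `a`, `b`, the energy
identity, and a modulus determined by `|ab|`. -/
lemma IsGeodesic.generic_structure {γ : ℝ → Fin 3 → ℝ} (hγ : IsGeodesic metric γ)
    (hunit : IsUnitSpeed metric γ) (hgen : IsGeneric γ) :
    ∃ a b : ℝ, a ≠ 0 ∧ b ≠ 0 ∧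
      (∀ t, velocity γ t 0 = a * Real.exp (2 * γ t 2) ∧
        velocity γ t 1 = b * Real.exp (-2 * γ t 2)) ∧
      (∀ t, a ^ 2 * Real.exp (2 * γ t 2) + b ^ 2 * Real.exp (-2 * γ t 2)
        + velocity γ t 2 ^ 2 = 1) ∧
      2 * |a * b| < 1 ∧
      ∀ t, modulus γ t = √((1 - 2 * |a * b|) / (1 + 2 * |a * b|)) := by
  obtain ⟨a, b, hab⟩ := hγ.exists_momenta
  have hconst : ∀ i : Fin 3, ¬ ∀ t, velocity γ t i = 0 := fun i h => hgen i
    ⟨γ 0 i, fun t => is_const_of_deriv_eq_zero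
      (fun t => (hasDerivAt_coord hγ.1 t i).differentiableAt) h t 0⟩
  have ha : a ≠ 0 := fun h => hconst 0 fun t => by rw [(hab t).1, h, zero_mul]
  have hb : b ≠ 0 := fun h => hconst 1 fun t => by rw [(hab t).2, h, zero_mul]
  have hexp : ∀ t, Real.exp (2 * γ t 2) * Real.exp (-2 * γ t 2) = 1 := fun t => by
    rw [← Real.exp_add]; simp
  have hE : ∀ t, a ^ 2 * Real.exp (2 * γ t 2) + b ^ 2 * Real.exp (-2 * γ t 2)
      + velocity γ t 2 ^ 2 = 1 := fun t => by
    have := hunit.innerAt_eq_one t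
    rw [(hab t).1, (hab t).2] at this
    linear_combination this -
      (a ^ 2 * Real.exp (2 * γ t 2) + b ^ 2 * Real.exp (-2 * γ t 2)) * hexp t
  refine ⟨a, b, ha, hb, hab, hE, ?_, fun t => ?_⟩
  -- Completing the square in the energy gives z'² + (|a|e^z - |b|e^{-z})² = 1 - 2|ab|, so 2|ab| ≥ 1
  -- would force z to be constant.
  · by_contra! hlt
    refine hconst 2 fun t => ?_
    have h1 : Real.exp (2 * γ t 2) = Real.exp (γ t 2) ^ 2 := by rw [← Real.exp_nat_mul]; simp
    have h2 : Real.exp (-2 * γ t 2) = Real.exp (-γ t 2) ^ 2 := by rw [← Real.exp_nat_mul]; simp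
    have h3 : Real.exp (γ t 2) * Real.exp (-γ t 2) = 1 := by rw [← Real.exp_add]; simp
    have h4 := hE t
    rw [h1, h2, ← sq_abs a, ← sq_abs b] at h4
    rw [abs_mul] at hlt
    have h5 : velocity γ t 2 ^ 2 + (|a| * Real.exp (γ t 2) - |b| * Real.exp (-γ t 2)) ^ 2
        = 1 - 2 * (|a| * |b|) := by
      linear_combination h4 - 2 * |a| * |b| * h3
    have h6 : velocity γ t 2 ^ 2 = 0 := by
      nlinarith [sq_nonneg (velocity γ t 2),
        sq_nonneg (|a| * Real.exp (γ t 2) - |b| * Real.exp (-γ t 2))]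
    exact pow_eq_zero_iff two_ne_zero |>.1 h6
  · have h : velocity γ t 0 * velocity γ t 1 = a * b := by
      rw [(hab t).1, (hab t).2]
      linear_combination a * b * hexp t
    rw [modulus, hunit t, h, one_pow]

/-- The height of a generic unit-speed geodesic with momenta `a`, `b` is periodic. -/
lemma IsGeodesic.height_periodic {γ : ℝ → Fin 3 → ℝ} (hγ : IsGeodesic metric γ) {a b k : ℝ}
    (ha : a ≠ 0) (hb : b ≠ 0) (hk0 : 0 < k) (hk1 : k < 1)
    (hμ : (1 - k ^ 2) / (1 + k ^ 2) = 2 * |a * b|)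
    (hab : ∀ t, velocity γ t 0 = a * Real.exp (2 * γ t 2) ∧
      velocity γ t 1 = b * Real.exp (-2 * γ t 2))
    (hE : ∀ t, a ^ 2 * Real.exp (2 * γ t 2) + b ^ 2 * Real.exp (-2 * γ t 2)
      + velocity γ t 2 ^ 2 = 1) :
    Function.Periodic (fun t => γ t 2) (period k) := by
  have ha' : 0 < |a| := abs_pos.2 ha
  have hb' : 0 < |b| := abs_pos.2 hb
  -- The equilibrium height, where a²e^{2z} and b²e^{-2z} both equal |ab|; measured from it the
  -- potential becomes 2|ab| cosh 2w.
  set c := Real.log (|b| / |a|) / 2 with hc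
  have hexpc : Real.exp (2 * c) = |b| / |a| := by
    rw [hc, mul_div_cancel₀ _ two_ne_zero, Real.exp_log (by positivity)]
  have hp : ∀ t, |a * b| * Real.exp (2 * (γ t 2 - c)) = a ^ 2 * Real.exp (2 * γ t 2) := fun t => by
    rw [mul_sub, Real.exp_sub, hexpc, abs_mul, ← sq_abs a]
    field_simp
  have hm : ∀ t, |a * b| * Real.exp (-(2 * (γ t 2 - c))) = b ^ 2 * Real.exp (-2 * γ t 2) :=
    fun t => by
    rw [show -(2 * (γ t 2 - c)) = -2 * γ t 2 + 2 * c by ring, Real.exp_add, hexpc, abs_mul,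
      ← sq_abs b]
    field_simp
  have hexp : ∀ t, Real.exp (2 * γ t 2) * Real.exp (-2 * γ t 2) = 1 := fun t => by
    rw [← Real.exp_add]; simp
  have := pendulum_periodic hk0 hk1 (w := fun t => γ t 2 - c) (v := fun t => velocity γ t 2)
    (fun t => (hasDerivAt_coord hγ.1 t 2).sub_const c)
    (fun t => (hγ.hasDerivAt_velocity t).2.2.congr_deriv <| by
      rw [hμ, Real.sinh_eq, (hab t).1, (hab t).2]
      linear_combination hp t - hm t +
        (b ^ 2 * Real.exp (-2 * γ t 2) - a ^ 2 * Real.exp (2 * γ t 2)) * hexp t)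
    (fun t => by
      rw [hμ, Real.cosh_eq]
      linear_combination hE t + hp t + hm t)
  intro t
  have h := this t
  simp only at h
  linarith

/-- A function with `T`-periodic derivative has constant increments over `T`. -/
lemma increment_eq_of_periodic_deriv {f f' : ℝ → ℝ} {T : ℝ} (hf : ∀ t, HasDerivAt f (f' t) t)
    (hT : Function.Periodic f' T) (s t : ℝ) : f (s + T) - f s = f (t + T) - f t := by
  have hd : ∀ t, HasDerivAt (fun t => f (t + T) - f t) 0 t := fun t =>
    (((hf (t + T)).comp_add_const t T).sub (hf t)).congr_deriv (by rw [hT t, sub_self])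
  exact is_const_of_deriv_eq_zero (fun t => (hd t).differentiableAt) (fun t => (hd t).deriv) s t

end Sol

end

theorem mainTheorem2 (γ : ℝ → Fin 3 → ℝ) (hγ : Sol.IsGeodesic Sol.metric γ)
    (hunit : Sol.IsUnitSpeed Sol.metric γ) (hgen : Sol.IsGeneric γ)
    (k t₀ : ℝ) (hk : Sol.modulus γ t₀ = k) (t₁ : ℝ) :
    0 < k ∧ k < 1 ∧ (∀ t, Sol.modulus γ t = k) ∧
    (Sol.velocity γ t₁ 2 = 0 →
      Sol.AreConjugateAlong Sol.metric γ t₁ (t₁ + Sol.period k)) ∧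
    (Sol.velocity γ t₁ 2 ≠ 0 →
      Sol.IsGeodesic Sol.metric (Sol.partner γ t₁) ∧
      Sol.IsUnitSpeed Sol.metric (Sol.partner γ t₁) ∧
      (∀ t, Sol.modulus (Sol.partner γ t₁) t = k) ∧
      Sol.partner γ t₁ t₁ = γ t₁ ∧
      Sol.partner γ t₁ (t₁ + Sol.period k) = γ (t₁ + Sol.period k) ∧
      Sol.arcLength Sol.metric γ t₁ (t₁ + Sol.period k) = Sol.period k ∧
      Sol.arcLength Sol.metric (Sol.partner γ t₁) t₁ (t₁ + Sol.period k) = Sol.period k ∧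
      Sol.partner γ t₁ '' Set.Icc t₁ (t₁ + Sol.period k) ≠
        γ '' Set.Icc t₁ (t₁ + Sol.period k)) := by
  obtain ⟨a, b, ha, hb, hab, hE, hlt, hmod⟩ := hγ.generic_structure hunit hgen
  have hpos : 0 < |a * b| := abs_pos.2 (mul_ne_zero ha hb)
  have hmodk : ∀ t, Sol.modulus γ t = k := fun t => by rw [← hk, hmod t, hmod t₀]
  have hkeq : k = √((1 - 2 * |a * b|) / (1 + 2 * |a * b|)) := by rw [← hk, hmod]
  have hq0 : 0 < (1 - 2 * |a * b|) / (1 + 2 * |a * b|) := div_pos (by linarith) (by linarith)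
  have hk0 : 0 < k := hkeq ▸ Real.sqrt_pos.2 hq0
  have hk2 : k ^ 2 = (1 - 2 * |a * b|) / (1 + 2 * |a * b|) := by rw [hkeq, Real.sq_sqrt hq0.le]
  have hk1 : k < 1 := by
    have : k ^ 2 < 1 := by rw [hk2, div_lt_one (by linarith)]; linarith
    nlinarith
  have hμ : (1 - k ^ 2) / (1 + k ^ 2) = 2 * |a * b| := by
    rw [hk2]
    field_simp
    ring
  have hT := Sol.period_pos hk0 hk1
  have hz := hγ.height_periodic ha hb hk0 hk1 hμ hab hE
  set T := Sol.period k
  have hz' : ∀ t, γ (t + T) 2 = γ t 2 := hz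
  have hv : ∀ i, Function.Periodic (fun t => Sol.velocity γ t i) T := by
    intro i t
    fin_cases i
    · simp [(hab _).1, hz']
    · simp [(hab _).2, hz']
    -- z' inherits the period of z by uniqueness of derivatives.
    · have h := (Sol.hasDerivAt_coord hγ.1 (t + T) 2).comp_add_const t T
      simp only [hz'] at h
      exact h.unique (Sol.hasDerivAt_coord hγ.1 t 2)
  refine ⟨hk0, hk1, hmodk, fun h0 => ⟨by linarith, _,
    hγ.isJacobiField_velocity_sub (Sol.velocity γ t₁ 0) (Sol.velocity γ t₁ 1), ?_, ?_, ?_⟩,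
    fun h0 => ?_⟩
  -- The third component of the Jacobi field is z', which is not identically zero since z is not
  -- constant.
  · by_contra! hJ
    refine hgen 2 ⟨γ 0 2, fun t => is_const_of_deriv_eq_zero
      (fun t => (Sol.hasDerivAt_coord hγ.1 t 2).differentiableAt) (fun s => ?_) t 0⟩
    have h2 : Sol.velocity γ s 2 = 0 := by simpa using congrFun (hJ s) 2
    exact h2
  · ext i
    fin_cases i <;> simp [h0]
  · ext i
    have h := hv i t₁
    fin_cases i <;> simp_all
  · have hunit' : Sol.IsUnitSpeed Sol.metric (Sol.partner γ t₁) := fun t => by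
      rw [Sol.speed_partner hγ.1, hunit]
    -- The start t₁ - T is the reflection of t₁ + T in t₁, where the partner evaluates γ.
    have hinc : ∀ i, γ (t₁ - T + T) i - γ (t₁ - T) i = γ (t₁ + T) i - γ t₁ i := fun i =>
      Sol.increment_eq_of_periodic_deriv (fun t => Sol.hasDerivAt_coord hγ.1 t i) (hv i) _ _
    refine ⟨hγ.partner t₁, hunit', fun t => by rw [Sol.modulus_partner hγ.1, hmodk], ?_, ?_,
      by rw [hunit.arcLength, add_sub_cancel_left],
      by rw [hunit'.arcLength, add_sub_cancel_left],
      Sol.image_partner_ne hγ.1 ha (fun t => (hab t).1) (by linarith) h0⟩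
    · ext i
      fin_cases i <;> simp [Sol.partner, show 2 * t₁ - t₁ = t₁ by ring] <;> ring
    · have hr : 2 * t₁ - (t₁ + T) = t₁ - T := by ring
      have h3 := hz' (t₁ - T)
      have h4 := hz' t₁
      have i0 := hinc 0
      have i1 := hinc 1
      rw [sub_add_cancel] at h3 i0 i1
      ext i
      fin_cases i <;> simp [Sol.partner, hr] <;> linarith
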